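/- Let $M\in\mathbb N$ and $\bm n\in\mathbb N^M$. For $\bm k,\bm l\in\mathbb N^M$ write $|\bm k|=\sum_i k_i$, $\bm l!=\prod_i l_i!$, $\binom{\bm l}{\bm k}=\prod_i\binom{l_i}{k_i}$, and $\bm k\le\bm l$ if $k_i\le l_i$ for all $i$. For $\bm x\in\mathbb R_+^M$ (where $\mathbb R_+=[0,\infty)$) let $$\mathcal L_{\bm k}(\bm x)=\prod_{i=1}^M(-1)^{k_i}L_{k_i}(x_i)e^{-x_i/2},\qquad L_k(x)=\sum_{l=0}^k\frac{(-1)^l}{l!}\binom kl x^l .$$ Let $\omega_{\bm n}^{L^2}$ be the optimal value of the linear program $(\mathrm{LP}_{\bm n}^{L^2})$: maximise $F_{\bm n}$ over real families $(F_{\bm k})_{\bm k\in\mathbb N^M}\in\ell^2(\mathbb N^M)$ subject to $\sum_{\bm k}F_{\bm k}=1$, $F_{\bm k}\ge0$ for all $\bm k$, and $\sum_{\bm k}F_{\bm k}\mathcal L_{\bm k}(\bm x)\ge0$ for all $\bm x\in\mathbb R_+^M$. For a finite set $I\subset\mathbb N^M$ containing $\bm n$, consider the semidefinite program: maximise $F_{\bm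 n}$ over real symmetric matrices $A=(A_{\bm i\bm j})_{\bm i,\bm j\in I}$ and vectors $\bm F=(F_{\bm k})_{\bm k\in I}\in\mathbb R^I$ subject to \begin{itemize} \item $\sum_{\bm k\in I}F_{\bm k}=1$ and $F_{\bm k}\ge0$ for all $\bm k\in I$; \item $A_{\bm i\bm j}=\sum_{\bm k\in I,\,\bm k\le\bm l}F_{\bm k}\binom{\bm l}{\bm k}\bm l!$ whenever $\bm i,\bm j,\bm l\in I$ and $\bm i+\bm j=2\bm l$; \item $A_{\bm i\bm j}=0$ whenever $\bm i,\bm j\in I$ and $\bm i+\bm j\ne2\bm l$ for all $\bm l\in I$; \item $A\succeq0$. \end{itemize} For $m\ge\max_i n_i$ let $(\mathrm{SDP}_{\bm n}^{m\bm 1,\ge})$ be this program for $I=\{\bm k: k_i\le m\text{ for all }i\}$, with optimal value $\omega_{\bm n}^{m\bm1,\ge}$; for $m\ge|\bm n|$ let $(\mathrm{SDP}_{\bm n}^{m,\ge})$ be this program for $I=\{\bm k:|\bm k|\le m\}$, with optimal value $\omega_{\bm n}^{m,\ge}$. Then all these programs are feasible with finite optimal values (suprema), the sequences $(\omega_{\bm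 n}^{m\bm1,\ge})_{m\ge\max_i n_i}$ and $(\omega_{\bm n}^{m,\ge})_{m\ge|\bm n|}$ are decreasing (in the weak sense), and $$\lim_{m\to\infty}\omega_{\bm n}^{m\bm1,\ge}=\omega_{\bm n}^{L^2},\qquad\lim_{m\to\infty}\omega_{\bm n}^{m,\ge}=\omega_{\bm n}^{L^2}.$$ -/

import Mathlib

namespace WignerSDP

/-- The Laguerre polynomial `L_k(x) = ∑_{l ≤ k} (-1)^l / l! * binom(k, l) * x^l`. -/
noncomputable def laguerrePoly (k : ℕ) (x : ℝ) : ℝ :=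
  ∑ l ∈ Finset.range (k + 1), (-1 : ℝ) ^ l / (l.factorial : ℝ) * (k.choose l : ℝ) * x ^ l

/-- The Laguerre function `(-1)^k L_k(x) exp(-x/2)`. -/
noncomputable def laguerreFun (k : ℕ) (x : ℝ) : ℝ :=
  (-1 : ℝ) ^ k * laguerrePoly k x * Real.exp (-x / 2)

/-- The multimode Laguerre function, the product of the one-variable ones. -/
noncomputable def multiLaguerreFun {M : ℕ} (k : Fin M → ℕ) (x : Fin M → ℝ) : ℝ :=
  ∏ i, laguerreFun (k i) (x i)

/-- The multi-index factorial `l! = ∏ l_i!`. -/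
def multiFactorial {M : ℕ} (l : Fin M → ℕ) : ℕ := ∏ i, (l i).factorial

/-- The multi-index binomial coefficient `binom(l, k) = ∏ binom(l_i, k_i)`. -/
def multiChoose {M : ℕ} (l k : Fin M → ℕ) : ℕ := ∏ i, (l i).choose (k i)

/-- Feasible points of the infinite-dimensional linear program over square-summable families. -/
structure LPFeasible {M : ℕ} (F : (Fin M → ℕ) → ℝ) : Prop where
  memℓp : Memℓp F 2
  hasSum : HasSum F 1
  nonneg : ∀ k, 0 ≤ F k
  summable_laguerre : ∀ x : Fin M → ℝ, (∀ i, 0 ≤ x i) →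
    Summable fun k => F k * multiLaguerreFun k x
  laguerre_nonneg : ∀ x : Fin M → ℝ, (∀ i, 0 ≤ x i) →
    0 ≤ ∑' k, F k * multiLaguerreFun k x

/-- The objective values `F_n` reached by the linear program. -/
def lpValues {M : ℕ} (n : Fin M → ℕ) : Set ℝ :=
  {v | ∃ F : (Fin M → ℕ) → ℝ, LPFeasible F ∧ v = F n}

/-- The optimal value of the linear program. -/
noncomputable def lpOptimum {M : ℕ} (n : Fin M → ℕ) : ℝ := sSup (lpValues n)

/-- Feasible points `(A, F)` of the semidefinite relaxation whose matrices and vectors are indexed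
by the finite set of multi-indices `I`. Positive semidefiniteness includes symmetry. -/
structure SDPFeasible {M : ℕ} (I : Finset (Fin M → ℕ)) (A : Matrix I I ℝ) (F : I → ℝ) :
    Prop where
  sum_eq_one : ∑ k, F k = 1
  nonneg : ∀ k, 0 ≤ F k
  even_entry : ∀ l i j : I, i.1 + j.1 = 2 • l.1 →
    A i j = ∑ k : I with ∀ a, k.1 a ≤ l.1 a,
      F k * (multiChoose l.1 k.1 : ℝ) * (multiFactorial l.1 : ℝ)
  odd_entry : ∀ i j : I, (∀ l : I, i.1 + j.1 ≠ 2 • l.1) → A i j = 0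
  posSemidef : A.PosSemidef

/-- The objective values `F_n` reached by the semidefinite relaxation indexed by `I`. -/
def sdpValues {M : ℕ} (I : Finset (Fin M → ℕ)) (n : Fin M → ℕ) : Set ℝ :=
  {v | ∃ (hn : n ∈ I) (A : Matrix I I ℝ) (F : I → ℝ), SDPFeasible I A F ∧ v = F ⟨n, hn⟩}

/-- The optimal value of the semidefinite relaxation indexed by `I`. -/
noncomputable def sdpOptimum {M : ℕ} (I : Finset (Fin M → ℕ)) (n : Fin M → ℕ) : ℝ :=
  sSup (sdpValues I n)

/-- The multi-indices all of whose entries are at most `m`. -/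
def boxIndices (M m : ℕ) : Finset (Fin M → ℕ) := Finset.Iic fun _ => m

/-- The multi-indices of total degree at most `m`. -/
def degreeIndices (M m : ℕ) : Finset (Fin M → ℕ) :=
  (Finset.Iic fun _ => m).filter fun k => ∑ i, k i ≤ m

theorem mem_boxIndices {M m : ℕ} {k : Fin M → ℕ} : k ∈ boxIndices M m ↔ ∀ i, k i ≤ m := by
  simp [boxIndices, Pi.le_def]

theorem mem_degreeIndices {M m : ℕ} {k : Fin M → ℕ} :
    k ∈ degreeIndices M m ↔ ∑ i, k i ≤ m := by
  simp only [degreeIndices, Finset.mem_filter, Finset.mem_Iic, Pi.le_def, and_iff_right_iff_imp]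
  exact fun h i => (Finset.single_le_sum (fun j _ => Nat.zero_le (k j)) (Finset.mem_univ i)).trans h

end WignerSDP

/-! The functions $\mathcal L_k$ are bounded by $1$ on the orthant (`abs_laguerreFun_le_one`), so a
nonnegative summable family $F$ defines a bounded continuous function $f=\sum_k F_k\mathcal L_k$.
Its moments against $x^l e^{-\sum_i x_i/2}$ are the finite sums $\sum_{k\le l}F_k\binom lk l!$
(`integral_laguerreSeries_mul_monom`), which are the entries prescribed for $A$. The program over
$I$ therefore sees $f$ only through finitely many moments.

LP below SDP: if $f\ge0$, substituting $x=r^2$ turns the matrix $A$ into a Gram-type matrix of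
monomials in $r$, split into parity classes, hence positive semidefinite
(`posSemidef_parityMomentMatrix`). Restricting $F$ to $I$ loses mass, but the constraints other than
the normalisation are homogeneous, and dividing by a mass at most $1$ only raises $F_n$. The same
truncation gives monotonicity in $I$ (`sdpOptimum_anti`).

SDP down to LP: feasible vectors, extended by zero, lie in the compact cube $[0,1]^{\mathbb N^M}$,
so near-optimal ones have a coordinatewise limit $F$ with sum at most $1$. Each moment involves
finitely many coordinates, so positivity passes to the limit: $\int f p^2 e^{-\sum_i x_i/2}\ge0$ for
every polynomial $p$. It remains to deduce $f\ge0$ pointwise. Taylor polynomials of exponentials let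
the weight decay arbitrarily faster (`NonnegOnSquares.add`); then squares of monomials times such
weights concentrate at any interior point (`NonnegOnSquares.nonneg_of_pos`). Normalising $F$ gives a
point feasible for the linear program. -/

namespace WignerSDP
open MeasureTheory

/-! ### Uniform bound on Laguerre functions through the Fock space norm. -/

/-- The Taylor coefficients of `(z - r)^n * exp (r z)`. -/
noncomputable def fockCoeff (r : ℝ) (n m : ℕ) : ℝ :=
  PowerSeries.coeff m
    ((PowerSeries.X - PowerSeries.C r) ^ n * PowerSeries.rescale r (PowerSeries.exp ℝ))

theorem fockCoeff_zero_left (r : ℝ) (m : ℕ) : fockCoeff r 0 m = r ^ m / m.factorial := by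
  simp [fockCoeff, PowerSeries.coeff_rescale, PowerSeries.coeff_exp, div_eq_mul_inv]

theorem fockCoeff_succ_zero (r : ℝ) (n : ℕ) :
    fockCoeff r (n + 1) 0 = -r * fockCoeff r n 0 := by
  simp only [fockCoeff, pow_succ', sub_mul, mul_assoc, map_sub, PowerSeries.coeff_zero_X_mul,
    PowerSeries.coeff_C_mul]
  ring

theorem fockCoeff_succ_succ (r : ℝ) (n m : ℕ) :
    fockCoeff r (n + 1) (m + 1) = fockCoeff r n m - r * fockCoeff r n (m + 1) := by
  simp only [fockCoeff, pow_succ', sub_mul, mul_assoc, map_sub, PowerSeries.coeff_succ_X_mul,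
    PowerSeries.coeff_C_mul]

/-- Coefficient form of $f_n'=rf_n+nf_{n-1}$ for $f_n=(z-r)^ne^{rz}$; at $n=0$ the truncated index
is harmless because of the factor $n$. -/
theorem fockCoeff_lowering (r : ℝ) (n m : ℕ) :
    (m + 1 : ℝ) * fockCoeff r n (m + 1) = r * fockCoeff r n m + n * fockCoeff r (n - 1) m := by
  induction n generalizing m with
  | zero =>
    simp only [fockCoeff_zero_left, Nat.factorial_succ]
    have : (m.factorial : ℝ) ≠ 0 := by positivity
    push_cast
    field_simp
    simp [pow_succ']
  | succ n ih =>
    cases m with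
    | zero =>
      have h := ih 0
      rw [fockCoeff_succ_succ, fockCoeff_succ_zero]
      cases n with
      | zero => simp at h ⊢; linear_combination -r * h
      | succ n =>
        simp only [Nat.add_sub_cancel] at h ⊢
        rw [fockCoeff_succ_zero] at h ⊢
        push_cast at h ⊢
        linear_combination -r * h
    | succ m =>
      have h := ih (m + 1)
      have h' := ih m
      rw [fockCoeff_succ_succ, fockCoeff_succ_succ]
      cases n with
      | zero => simp at h h' ⊢; linear_combination -r * h + h'
      | succ n =>
        simp only [Nat.add_sub_cancel] at h h' ⊢
        have h2 := fockCoeff_succ_succ r n m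
        push_cast at h h' ⊢
        linear_combination -r * h + h' - (n + 1) * h2

theorem exists_abs_fockCoeff_le (r : ℝ) (n : ℕ) :
    ∃ C R : ℝ, 0 ≤ C ∧ 1 ≤ R ∧ ∀ m, |fockCoeff r n m| ≤ C * R ^ m / m.factorial := by
  induction n with
  | zero =>
    refine ⟨1, |r| + 1, zero_le_one, by simp, fun m => ?_⟩
    rw [fockCoeff_zero_left, abs_div, abs_pow, Nat.abs_cast, one_mul]
    gcongr
    simp
  | succ n ih =>
    obtain ⟨C, R, hC, hR, h⟩ := ih
    -- Doubling $R$ absorbs the factor $m+1$ lost when the coefficient index is shifted.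
    refine ⟨C * (1 + |r|), 2 * R, by positivity, by linarith, fun m => ?_⟩
    cases m with
    | zero =>
      have := h 0
      rw [fockCoeff_succ_zero, abs_mul, abs_neg]
      simp at this ⊢
      nlinarith [abs_nonneg r]
    | succ m =>
      have h1 : |fockCoeff r n m| ≤ C * (2 * R) ^ (m + 1) / (m + 1).factorial := by
        refine (h m).trans ?_
        rw [div_le_div_iff₀ (by positivity) (by positivity), Nat.factorial_succ]
        have h2 : ((m + 1 : ℕ) : ℝ) ≤ 2 ^ (m + 1) := by
          exact_mod_cast (Nat.lt_two_pow_self).le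
        have h3 : R ^ m ≤ R ^ (m + 1) := pow_le_pow_right₀ hR (Nat.le_succ m)
        have : C * (R ^ m * ((m + 1 : ℕ) : ℝ)) * m.factorial
            ≤ C * (R ^ (m + 1) * 2 ^ (m + 1)) * m.factorial := by gcongr
        rw [mul_pow]
        push_cast at this ⊢
        linarith
      have h2 : |fockCoeff r n (m + 1)| ≤ C * (2 * R) ^ (m + 1) / (m + 1).factorial := by
        refine (h (m + 1)).trans ?_
        gcongr
        linarith
      rw [fockCoeff_succ_succ]
      calc _ ≤ |fockCoeff r n m| + |r| * |fockCoeff r n (m + 1)| := by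
              rw [← abs_mul]; exact abs_sub _ _
        _ ≤ C * (2 * R) ^ (m + 1) / (m + 1).factorial
            + |r| * (C * (2 * R) ^ (m + 1) / (m + 1).factorial) := by gcongr
        _ = _ := by ring

theorem summable_fockCoeff_mul (r : ℝ) (n n' s : ℕ) :
    Summable fun m : ℕ => ((m + s).factorial : ℝ) * fockCoeff r n (m + s) * fockCoeff r n' m := by
  obtain ⟨C, R, hC, hR, h⟩ := exists_abs_fockCoeff_le r n
  obtain ⟨C', R', hC', hR', h'⟩ := exists_abs_fockCoeff_le r n'
  refine Summable.of_norm_bounded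
    ((Real.summable_pow_div_factorial (R * R')).mul_left (C * C' * R ^ s)) fun m => ?_
  rw [Real.norm_eq_abs, abs_mul, abs_mul, Nat.abs_cast]
  calc _ ≤ ((m + s).factorial : ℝ) * (C * R ^ (m + s) / (m + s).factorial)
        * (C' * R' ^ m / m.factorial) := by gcongr; exacts [h _, h' _]
    _ = _ := by
      have : ((m + s).factorial : ℝ) ≠ 0 := by positivity
      field_simp
      ring

/-- For the pairing $\langle a,b\rangle=\sum_m m!\,a_mb_m$, multiplication by $z$ is adjoint to
$d/dz$. Hence $\langle f_{n+1},f_{n+1}\rangle=\langle f_n,(d/dz-r)f_{n+1}\rangle=(n+1)\langle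
f_n,f_n\rangle$. -/
theorem tsum_fockCoeff_sq (r : ℝ) (n : ℕ) :
    ∑' m : ℕ, (m.factorial : ℝ) * fockCoeff r n m * fockCoeff r n m
      = n.factorial * Real.exp (r ^ 2) := by
  induction n with
  | zero =>
    rw [Real.exp_eq_exp_ℝ, NormedSpace.exp_eq_tsum_div]
    simp only [fockCoeff_zero_left, Nat.factorial_zero, Nat.cast_one, one_mul]
    refine tsum_congr fun m => ?_
    have : (m.factorial : ℝ) ≠ 0 := by positivity
    field_simp
    ring
  | succ n ih =>
    have s0 := summable_fockCoeff_mul r (n + 1) (n + 1) 0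
    have s1 := summable_fockCoeff_mul r (n + 1) n 1
    have s2 := (summable_fockCoeff_mul r (n + 1) n 0).mul_left r
    have s3 := (summable_fockCoeff_mul r n n 0).mul_left (n + 1 : ℝ)
    simp only [add_zero] at s0 s2 s3
    have e1 : ∑' m : ℕ, (m.factorial : ℝ) * fockCoeff r (n + 1) m * fockCoeff r (n + 1) m
        = ∑' m : ℕ, ((m + 1).factorial : ℝ) * fockCoeff r (n + 1) (m + 1) * fockCoeff r n m
        - ∑' m : ℕ, r * ((m.factorial : ℝ) * fockCoeff r (n + 1) m * fockCoeff r n m) := by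
      rw [s0.tsum_eq_zero_add, s2.tsum_eq_zero_add]
      have s2' := (summable_nat_add_iff 1).2 s2
      rw [sub_add_eq_sub_sub, sub_right_comm, ← s1.tsum_sub s2', fockCoeff_succ_zero]
      simp only [fockCoeff_succ_succ]
      rw [add_comm, sub_eq_add_neg]
      congr 1
      · exact tsum_congr fun m => by ring
      · ring
    rw [e1, ← s1.tsum_sub s2, Nat.factorial_succ]
    push_cast
    rw [mul_assoc, ← ih, ← tsum_mul_left]
    refine tsum_congr fun m => ?_
    have h := fockCoeff_lowering r (n + 1) m
    simp only [Nat.add_sub_cancel] at h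
    push_cast [Nat.factorial_succ] at h ⊢
    linear_combination (m.factorial : ℝ) * fockCoeff r n m * h

theorem fockCoeff_self (r : ℝ) (n : ℕ) : fockCoeff r n n = laguerrePoly n (r ^ 2) := by
  have e : ∀ i, PowerSeries.coeff i ((PowerSeries.X - PowerSeries.C r : PowerSeries ℝ) ^ n)
      = (-r) ^ (n - i) * (n.choose i : ℝ) := by
    intro i
    rw [← Polynomial.coeff_X_add_C_pow, ← Polynomial.coeff_coe]
    simp [sub_eq_add_neg]
  rw [fockCoeff, laguerrePoly, mul_comm, PowerSeries.coeff_mul,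
    Finset.Nat.sum_antidiagonal_eq_sum_range_succ_mk]
  refine Finset.sum_congr rfl fun j hj => ?_
  have hj : j ≤ n := by simpa [Nat.lt_succ_iff] using hj
  simp only [PowerSeries.coeff_rescale, PowerSeries.coeff_exp, e]
  rw [Nat.choose_symm hj, Nat.sub_sub_self hj, neg_pow]
  simp
  ring

/-- With $r=\sqrt x$, the diagonal term $k!\,L_k(x)^2$ of the norm series is at most its sum
$k!\,e^x$. -/
theorem abs_laguerreFun_le_one (k : ℕ) {x : ℝ} (hx : 0 ≤ x) : |laguerreFun k x| ≤ 1 := by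
  have h1 := tsum_fockCoeff_sq (√x) k
  have s0 := summable_fockCoeff_mul (√x) k k 0
  simp only [add_zero] at s0
  have h2 := s0.le_tsum k fun j _ => by
    rw [mul_assoc]; exact mul_nonneg (by positivity) (mul_self_nonneg _)
  rw [h1, fockCoeff_self, Real.sq_sqrt hx, mul_assoc] at h2
  have h3 := le_of_mul_le_mul_left h2 (by positivity)
  have h4 : |laguerrePoly k x| ≤ Real.exp (x / 2) := by
    refine abs_le_of_sq_le_sq ?_ (Real.exp_nonneg _)
    rw [← Real.exp_nat_mul]
    push_cast
    rw [mul_div_cancel₀ _ two_ne_zero]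
    linarith [sq (laguerrePoly k x)]
  rw [laguerreFun, abs_mul, abs_mul, abs_pow, abs_neg, abs_one, one_pow, one_mul, Real.abs_exp]
  calc _ ≤ Real.exp (x / 2) * Real.exp (-x / 2) := by gcongr
    _ = 1 := by rw [← Real.exp_add]; simp [neg_div]

/-! ### Moments of the one-variable Laguerre functions. -/

/-- Up to sign, the left side is the $k$-th forward difference of $x\mapsto\binom xl$ at $x=l$: it
is $\binom l{l-k}$ for $k\le l$ and vanishes beyond the degree. -/
theorem sum_neg_one_pow_mul_choose_mul_choose (k l : ℕ) :
    ∑ j ∈ Finset.range (k + 1), (-1 : ℝ) ^ j * k.choose j * (l + j).choose l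
      = (-1) ^ k * l.choose k := by
  have h : (fwdDiff 1)^[k] (fun x => x.choose l : ℕ → ℤ) l = l.choose k := by
    rcases le_or_gt k l with hkl | hkl
    · obtain ⟨j, rfl⟩ := Nat.exists_eq_add_of_le hkl
      rw [fwdDiff_iter_choose j k]
      exact congrArg Nat.cast Nat.choose_symm_add.symm
    · obtain ⟨j, rfl⟩ := Nat.exists_eq_add_of_lt hkl
      have h0 := fwdDiff_iter_choose 0 l
      simp only [add_zero, Nat.choose_zero_right, Nat.cast_one] at h0
      rw [show l + j + 1 = (j + 1) + l by ring, Function.iterate_add_apply, h0,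
        Function.iterate_succ_apply, Nat.choose_eq_zero_of_lt (by omega)]
      have : fwdDiff 1 (fun _ : ℕ => (1 : ℤ)) = 0 := by ext; simp [fwdDiff]
      rw [this, fwdDiff_iter_eq_sum_shift]
      simp
  rw [fwdDiff_iter_eq_sum_shift] at h
  have h' := congrArg (fun z : ℤ => (-1 : ℝ) ^ k * z) h
  push_cast [smul_eq_mul] at h'
  rw [← h', Finset.mul_sum]
  refine Finset.sum_congr rfl fun j hj => ?_
  have hj : j ≤ k := by simpa [Nat.lt_succ_iff] using hj
  have e : (-1 : ℝ) ^ k * (-1) ^ (k - j) = (-1) ^ j := by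
    rw [← pow_add, show k + (k - j) = 2 * (k - j) + j by omega, pow_add, pow_mul]
    simp
  rw [← e]
  simp
  ring

theorem integrableOn_pow_mul_exp_neg_mul {b : ℝ} (hb : 0 < b) (l : ℕ) :
    Integrable (fun x : ℝ => x ^ l * Real.exp (-(b * x))) (volume.restrict (Set.Ici 0)) := by
  rw [Measure.restrict_congr_set Ioi_ae_eq_Ici.symm]
  have := integrableOn_rpow_mul_exp_neg_mul_rpow (p := 1) (s := l) (b := b)
    (by have : (0 : ℝ) ≤ l := by positivity
        linarith) one_pos hb
  refine this.congr_fun (fun x _ => ?_) measurableSet_Ioi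
  simp

theorem integral_pow_mul_exp_neg (l : ℕ) :
    ∫ x in Set.Ici (0 : ℝ), x ^ l * Real.exp (-x) = l.factorial := by
  rw [Measure.restrict_congr_set Ioi_ae_eq_Ici.symm, ← Real.Gamma_nat_eq_factorial,
    Real.Gamma_eq_integral (by positivity)]
  refine setIntegral_congr_fun measurableSet_Ioi fun x _ => ?_
  simp [mul_comm]

theorem laguerreFun_mul_exp_mul_pow (k l : ℕ) (x : ℝ) :
    laguerreFun k x * (x ^ l * Real.exp (-x / 2)) = ∑ j ∈ Finset.range (k + 1),
      ((-1) ^ k * ((-1 : ℝ) ^ j / j.factorial * k.choose j)) *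
        (x ^ (l + j) * Real.exp (-(1 * x))) := by
  have : Real.exp (-(1 * x)) = Real.exp (-x / 2) * Real.exp (-x / 2) := by
    rw [← Real.exp_add]; ring_nf
  rw [this, laguerreFun, laguerrePoly, Finset.mul_sum, Finset.sum_mul, Finset.sum_mul]
  exact Finset.sum_congr rfl fun j _ => by ring

theorem integrable_laguerreFun_mul_exp_mul_pow (k l : ℕ) :
    Integrable (fun x => laguerreFun k x * (x ^ l * Real.exp (-x / 2)))
      (volume.restrict (Set.Ici 0)) := by
  simp only [laguerreFun_mul_exp_mul_pow]
  exact integrable_finsetSum _ fun j _ =>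
    (integrableOn_pow_mul_exp_neg_mul one_pos (l + j)).const_mul _

theorem integral_laguerreFun_mul_exp_mul_pow (k l : ℕ) :
    ∫ x in Set.Ici (0 : ℝ), laguerreFun k x * (x ^ l * Real.exp (-x / 2))
      = l.choose k * l.factorial := by
  simp only [laguerreFun_mul_exp_mul_pow]
  rw [integral_finsetSum _ fun j _ =>
    (integrableOn_pow_mul_exp_neg_mul one_pos (l + j)).const_mul _]
  simp only [integral_const_mul, one_mul, integral_pow_mul_exp_neg]
  have e := congrArg (fun z : ℝ => (-1 : ℝ) ^ k * l.factorial * z)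
    (sum_neg_one_pow_mul_choose_mul_choose k l)
  have e2 : (-1 : ℝ) ^ k * l.factorial * ((-1) ^ k * l.choose k) = l.choose k * l.factorial := by
    have : (-1 : ℝ) ^ k * (-1) ^ k = 1 := by rw [← mul_pow]; simp
    linear_combination (l.factorial * l.choose k : ℝ) * this
  rw [← e2, ← e, Finset.mul_sum]
  refine Finset.sum_congr rfl fun j _ => ?_
  have h1 : ((l + j).factorial : ℝ) = (l + j).choose l * l.factorial * j.factorial := by
    rw [← Nat.add_choose_mul_factorial_mul_factorial l j, Nat.choose_symm_add]
    push_cast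
    rfl
  have h2 : (j.factorial : ℝ) ≠ 0 := by positivity
  rw [h1]
  field_simp

/-! ### Integration on the orthant and multivariate moments. -/

/-- Lebesgue measure on the nonnegative orthant. -/
noncomputable def orthantMeasure (M : ℕ) : Measure (Fin M → ℝ) := volume.restrict (Set.Ici 0)

theorem orthantMeasure_eq_pi (M : ℕ) :
    orthantMeasure M = Measure.pi fun _ => volume.restrict (Set.Ici 0) := by
  rw [orthantMeasure, ← Set.pi_univ_Ici, volume_pi, Measure.restrict_pi_pi]
  rfl

theorem ae_orthantMeasure_nonneg (M : ℕ) : ∀ᵐ x ∂orthantMeasure M, ∀ i, 0 ≤ x i :=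
  (ae_restrict_mem measurableSet_Ici).mono fun _ hx => hx

/-- The monomial with exponent `l`. -/
noncomputable def monom {M : ℕ} (l : Fin M → ℕ) (x : Fin M → ℝ) : ℝ := ∏ i, x i ^ l i

/-- The exponential weight `exp (-b · x)`. -/
noncomputable def expWeight {M : ℕ} (b x : Fin M → ℝ) : ℝ := Real.exp (-∑ i, b i * x i)

theorem expWeight_eq_prod {M : ℕ} (b x : Fin M → ℝ) :
    expWeight b x = ∏ i, Real.exp (-(b i * x i)) := by
  rw [expWeight, ← Finset.sum_neg_distrib, Real.exp_sum]

theorem expWeight_add {M : ℕ} (b c x : Fin M → ℝ) :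
    expWeight (b + c) x = expWeight b x * expWeight c x := by
  rw [expWeight, expWeight, expWeight, ← Real.exp_add]
  simp [add_mul, Finset.sum_add_distrib]
  ring

theorem expWeight_pos {M : ℕ} (b x : Fin M → ℝ) : 0 < expWeight b x := Real.exp_pos _

theorem integrable_monom_mul_expWeight {M : ℕ} {b : Fin M → ℝ} (hb : ∀ i, 0 < b i)
    (l : Fin M → ℕ) : Integrable (fun x => monom l x * expWeight b x) (orthantMeasure M) := by
  rw [orthantMeasure_eq_pi]
  simp only [monom, expWeight_eq_prod, ← Finset.prod_mul_distrib]
  exact Integrable.fintype_prod (f := fun i t => t ^ l i * Real.exp (-(b i * t)))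
    fun i => integrableOn_pow_mul_exp_neg_mul (hb i) (l i)

theorem integrable_eval_mul_expWeight {M : ℕ} {b : Fin M → ℝ} (hb : ∀ i, 0 < b i)
    (p : MvPolynomial (Fin M) ℝ) :
    Integrable (fun x => MvPolynomial.eval x p * expWeight b x) (orthantMeasure M) := by
  simp only [MvPolynomial.eval_eq', Finset.sum_mul, mul_assoc]
  exact integrable_finsetSum _ fun d _ => (integrable_monom_mul_expWeight hb d).const_mul _

theorem multiLaguerreFun_mul_monom_mul_expWeight {M : ℕ} (k l : Fin M → ℕ) (x : Fin M → ℝ) :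
    multiLaguerreFun k x * (monom l x * expWeight (fun _ => 1 / 2) x)
      = ∏ i, laguerreFun (k i) (x i) * (x i ^ l i * Real.exp (-x i / 2)) := by
  rw [multiLaguerreFun, monom, expWeight_eq_prod, ← Finset.prod_mul_distrib,
    ← Finset.prod_mul_distrib]
  refine Finset.prod_congr rfl fun i _ => ?_
  ring_nf

theorem integrable_multiLaguerreFun_mul {M : ℕ} (k l : Fin M → ℕ) :
    Integrable (fun x => multiLaguerreFun k x * (monom l x * expWeight (fun _ => 1 / 2) x))
      (orthantMeasure M) := by
  simp only [multiLaguerreFun_mul_monom_mul_expWeight, orthantMeasure_eq_pi]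
  exact Integrable.fintype_prod
    (f := fun i t => laguerreFun (k i) t * (t ^ l i * Real.exp (-t / 2)))
    fun i => integrable_laguerreFun_mul_exp_mul_pow (k i) (l i)

theorem integral_multiLaguerreFun_mul {M : ℕ} (k l : Fin M → ℕ) :
    ∫ x, multiLaguerreFun k x * (monom l x * expWeight (fun _ => 1 / 2) x) ∂orthantMeasure M
      = multiChoose l k * multiFactorial l := by
  simp only [multiLaguerreFun_mul_monom_mul_expWeight, orthantMeasure_eq_pi]
  rw [integral_fintype_prod_eq_prod
    (f := fun i t => laguerreFun (k i) t * (t ^ l i * Real.exp (-t / 2)))]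
  simp only [integral_laguerreFun_mul_exp_mul_pow, multiChoose, multiFactorial,
    Finset.prod_mul_distrib, Nat.cast_prod]

theorem continuous_laguerreFun (k : ℕ) : Continuous (laguerreFun k) := by
  unfold laguerreFun laguerrePoly; fun_prop

theorem continuous_multiLaguerreFun {M : ℕ} (k : Fin M → ℕ) : Continuous (multiLaguerreFun k) :=
  continuous_finsetProd _ fun i _ => (continuous_laguerreFun (k i)).comp (continuous_apply i)

theorem abs_multiLaguerreFun_le_one {M : ℕ} (k : Fin M → ℕ) {x : Fin M → ℝ} (hx : ∀ i, 0 ≤ x i) :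
    |multiLaguerreFun k x| ≤ 1 := by
  rw [multiLaguerreFun, Finset.abs_prod]
  exact Finset.prod_le_one (fun _ _ => abs_nonneg _) fun i _ => abs_laguerreFun_le_one _ (hx i)

/-! ### Laguerre series with nonnegative summable coefficients. -/

/-- The function on the orthant with Laguerre coefficients `F`. -/
noncomputable def laguerreSeries {M : ℕ} (F : (Fin M → ℕ) → ℝ) (x : Fin M → ℝ) : ℝ :=
  ∑' k, F k * multiLaguerreFun k x

/-- The `l`-th moment of `laguerreSeries F` against the weight `exp (-∑ x_i / 2)`. -/
noncomputable def laguerreMoment {M : ℕ} (F : (Fin M → ℕ) → ℝ) (l : Fin M → ℕ) : ℝ :=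
  ∑ k ∈ Finset.Iic l, F k * (multiChoose l k : ℝ) * (multiFactorial l : ℝ)

section Series

variable {M : ℕ} {F : (Fin M → ℕ) → ℝ}

theorem norm_mul_multiLaguerreFun_le (h0 : ∀ k, 0 ≤ F k) (k : Fin M → ℕ) {x : Fin M → ℝ}
    (hx : ∀ i, 0 ≤ x i) : ‖F k * multiLaguerreFun k x‖ ≤ F k := by
  rw [norm_mul, Real.norm_of_nonneg (h0 k)]
  exact mul_le_of_le_one_right (h0 k) (abs_multiLaguerreFun_le_one k hx)

theorem summable_mul_multiLaguerreFun (h0 : ∀ k, 0 ≤ F k) (hF : Summable F) {x : Fin M → ℝ}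
    (hx : ∀ i, 0 ≤ x i) : Summable fun k => F k * multiLaguerreFun k x :=
  hF.of_norm_bounded fun k => norm_mul_multiLaguerreFun_le h0 k hx

theorem norm_laguerreSeries_le (h0 : ∀ k, 0 ≤ F k) (hF : Summable F) {x : Fin M → ℝ}
    (hx : ∀ i, 0 ≤ x i) : ‖laguerreSeries F x‖ ≤ ∑' k, F k :=
  tsum_of_norm_bounded hF.hasSum fun k => norm_mul_multiLaguerreFun_le h0 k hx

theorem continuousOn_laguerreSeries (h0 : ∀ k, 0 ≤ F k) (hF : Summable F) :
    ContinuousOn (laguerreSeries F) (Set.Ici 0) :=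
  continuousOn_tsum
    (fun k => (continuous_const.mul (continuous_multiLaguerreFun k)).continuousOn) hF
    fun k _ hx => norm_mul_multiLaguerreFun_le h0 k hx

theorem aestronglyMeasurable_laguerreSeries (h0 : ∀ k, 0 ≤ F k) (hF : Summable F) :
    AEStronglyMeasurable (laguerreSeries F) (orthantMeasure M) :=
  (continuousOn_laguerreSeries h0 hF).aestronglyMeasurable measurableSet_Ici

theorem integrable_laguerreSeries_mul (h0 : ∀ k, 0 ≤ F k) (hF : Summable F)
    {g : (Fin M → ℝ) → ℝ} (hg : Integrable g (orthantMeasure M)) :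
    Integrable (fun x => laguerreSeries F x * g x) (orthantMeasure M) :=
  hg.bdd_mul (aestronglyMeasurable_laguerreSeries h0 hF)
    ((ae_orthantMeasure_nonneg M).mono fun _ hx => norm_laguerreSeries_le h0 hF hx)

theorem integral_laguerreSeries_mul_monom (h0 : ∀ k, 0 ≤ F k) (hF : Summable F)
    (l : Fin M → ℕ) :
    ∫ x, laguerreSeries F x * (monom l x * expWeight (fun _ => 1 / 2) x) ∂orthantMeasure M
      = laguerreMoment F l := by
  have hg : Integrable (fun x => monom l x * expWeight (fun _ => 1 / 2) x) (orthantMeasure M) :=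
    integrable_monom_mul_expWeight (fun _ => by norm_num) l
  have hint : ∀ k, Integrable (fun x => F k *
      (multiLaguerreFun k x * (monom l x * expWeight (fun _ => 1 / 2) x))) (orthantMeasure M) :=
    fun k => (integrable_multiLaguerreFun_mul k l).const_mul _
  have key := hasSum_integral_of_summable_integral_norm hint <| by
    refine Summable.of_nonneg_of_le (fun k => integral_nonneg fun _ => norm_nonneg _) (fun k => ?_)
      (hF.mul_right (∫ x, ‖monom l x * expWeight (fun _ => 1 / 2) x‖ ∂orthantMeasure M))
    rw [← integral_const_mul]
    refine integral_mono_ae (hint k).norm (hg.norm.const_mul _)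
      ((ae_orthantMeasure_nonneg M).mono fun x hx => ?_)
    dsimp only
    rw [← mul_assoc, norm_mul]
    exact mul_le_mul_of_nonneg_right (norm_mul_multiLaguerreFun_le h0 k hx) (norm_nonneg _)
  simp only [← mul_assoc, tsum_mul_right] at key
  simp only [← mul_assoc, laguerreSeries]
  -- The series of moments is finite, since $\binom lk=0$ unless $k\le l$.
  rw [← key.tsum_eq, laguerreMoment, tsum_eq_sum (s := Finset.Iic l)]
  · refine Finset.sum_congr rfl fun k _ => ?_
    simp only [mul_assoc, integral_const_mul]
    rw [← integral_multiLaguerreFun_mul]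
  · intro k hk
    simp only [mul_assoc, integral_const_mul]
    rw [integral_multiLaguerreFun_mul]
    simp only [Finset.mem_Iic, Pi.le_def, not_forall, not_le] at hk
    obtain ⟨i, hi⟩ := hk
    rw [multiChoose, Finset.prod_eq_zero (Finset.mem_univ i) (Nat.choose_eq_zero_of_lt hi)]
    simp

end Series

/-! ### Positivity on squares of polynomials under faster decaying weights. -/

section Polynomials

variable {M : ℕ} {F : (Fin M → ℕ) → ℝ}

/-- Nonnegativity of `laguerreSeries F` against squares of polynomials with weight `exp (-b · x)`. -/
def NonnegOnSquares {M : ℕ} (F : (Fin M → ℕ) → ℝ) (b : Fin M → ℝ) : Prop :=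
  ∀ p : MvPolynomial (Fin M) ℝ, 0 ≤ ∫ x, laguerreSeries F x *
    (MvPolynomial.eval x p ^ 2 * expWeight b x) ∂orthantMeasure M

theorem monom_add (i j : Fin M → ℕ) (x : Fin M → ℝ) :
    monom (i + j) x = monom i x * monom j x := by
  simp [monom, pow_add, Finset.prod_mul_distrib]

theorem nonnegOnSquares_of_moments (h0 : ∀ k, 0 ≤ F k) (hF : Summable F)
    (h : ∀ (s : Finset (Fin M →₀ ℕ)) (c : (Fin M →₀ ℕ) → ℝ),
      0 ≤ ∑ i ∈ s, ∑ j ∈ s, c i * laguerreMoment F (i + j) * c j) :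
    NonnegOnSquares F fun _ => 1 / 2 := by
  intro p
  have e : ∀ x, laguerreSeries F x * (MvPolynomial.eval x p ^ 2 * expWeight (fun _ => 1 / 2) x)
      = ∑ i ∈ p.support, ∑ j ∈ p.support, (p.coeff i * p.coeff j) *
        (laguerreSeries F x * (monom (i + j) x * expWeight (fun _ => 1 / 2) x)) := by
    intro x
    rw [MvPolynomial.eval_eq', sq, Finset.sum_mul_sum, Finset.sum_mul, Finset.mul_sum]
    refine Finset.sum_congr rfl fun i _ => ?_
    rw [Finset.sum_mul, Finset.mul_sum]
    refine Finset.sum_congr rfl fun j _ => ?_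
    rw [Finsupp.coe_add, monom_add, monom, monom]
    ring
  have hint : ∀ i j : Fin M →₀ ℕ, Integrable (fun x => (p.coeff i * p.coeff j) *
        (laguerreSeries F x * (monom (i + j) x * expWeight (fun _ => 1 / 2) x)))
        (orthantMeasure M) := fun i j =>
    (integrable_laguerreSeries_mul h0 hF
      (integrable_monom_mul_expWeight (fun _ => by norm_num) _)).const_mul _
  simp only [e]
  rw [integral_finsetSum _ fun i _ => integrable_finsetSum _ fun j _ => hint i j]
  refine (h p.support p.coeff).trans_eq (Finset.sum_congr rfl fun i _ => ?_)
  rw [integral_finsetSum _ fun j _ => hint i j]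
  refine Finset.sum_congr rfl fun j _ => ?_
  rw [integral_const_mul, integral_laguerreSeries_mul_monom h0 hF, Finsupp.coe_add]
  ring

theorem integrable_eval_sq_mul_expWeight {b : Fin M → ℝ} (hb : ∀ i, 0 < b i)
    (p : MvPolynomial (Fin M) ℝ) :
    Integrable (fun x => MvPolynomial.eval x p ^ 2 * expWeight b x) (orthantMeasure M) := by
  have h := integrable_eval_mul_expWeight hb (p ^ 2)
  have e : ∀ x, MvPolynomial.eval x (p ^ 2) = MvPolynomial.eval x p ^ 2 := fun x => map_pow _ _ _
  simpa only [e] using h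

/-- Multiply $p$ by Taylor polynomials of $e^{-a\cdot x}$; after squaring, the weight gains
$e^{-2a\cdot x}$ in the limit. -/
theorem NonnegOnSquares.add_small (h0 : ∀ k, 0 ≤ F k) (hF : Summable F) {a b : Fin M → ℝ}
    (hb : ∀ i, 1 / 2 ≤ b i) (ha : ∀ i, 0 ≤ a i) (ha' : ∀ i, a i ≤ 1 / 8)
    (h : NonnegOnSquares F b) : NonnegOnSquares F (b + (a + a)) := by
  intro p
  let q : ℕ → MvPolynomial (Fin M) ℝ := fun N => p * ∑ j ∈ Finset.range N,
    MvPolynomial.C ((j.factorial : ℝ)⁻¹) * (-∑ i, MvPolynomial.C (a i) * MvPolynomial.X i) ^ j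
  have hq : ∀ N x, MvPolynomial.eval x (q N) = MvPolynomial.eval x p *
      ∑ j ∈ Finset.range N, (-∑ i, a i * x i) ^ j / j.factorial := by
    intro N x
    simp [q, div_eq_mul_inv, mul_comm]
  have hlim : Filter.Tendsto (fun N => ∫ x, laguerreSeries F x *
      (MvPolynomial.eval x (q N) ^ 2 * expWeight b x) ∂orthantMeasure M) Filter.atTop
      (nhds (∫ x, laguerreSeries F x *
        (MvPolynomial.eval x p ^ 2 * expWeight (b + (a + a)) x) ∂orthantMeasure M)) := by
    -- The squared Taylor polynomials are dominated only by $e^{2a\cdot x}$; $a_i\le1/8$ and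
    -- $b_i\ge1/2$ keep this integrable against $e^{-b\cdot x}$.
    have hb' : ∀ i, 0 < (b - (a + a)) i := fun i => by
      have := hb i; have := ha' i
      simp only [Pi.sub_apply, Pi.add_apply]; linarith
    refine tendsto_integral_of_dominated_convergence
      (fun x => (∑' k, F k) * (MvPolynomial.eval x p ^ 2 * expWeight (b - (a + a)) x))
      (fun N => (integrable_laguerreSeries_mul h0 hF
        (integrable_eval_sq_mul_expWeight (fun i => by linarith [hb i]) (q N))).1)
      ((integrable_eval_sq_mul_expWeight hb' p).const_mul _)
      (fun N => (ae_orthantMeasure_nonneg M).mono fun x hx => ?_)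
      (Filter.Eventually.of_forall fun x => ?_)
    · have hs : 0 ≤ ∑ i, a i * x i := Finset.sum_nonneg fun i _ => mul_nonneg (ha i) (hx i)
      have hT : |∑ j ∈ Finset.range N, (-∑ i, a i * x i) ^ j / j.factorial|
          ≤ Real.exp (∑ i, a i * x i) := by
        refine (Finset.abs_sum_le_sum_abs _ _).trans (le_trans (le_of_eq ?_)
          (Real.sum_le_exp_of_nonneg hs N))
        refine Finset.sum_congr rfl fun j _ => ?_
        rw [abs_div, abs_pow, abs_neg, abs_of_nonneg hs, Nat.abs_cast]
      have hw : expWeight (b - (a + a)) x = Real.exp (∑ i, a i * x i) ^ 2 * expWeight b x := by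
        rw [expWeight, expWeight, ← Real.exp_nat_mul, ← Real.exp_add]
        simp only [Pi.sub_apply, Pi.add_apply, sub_mul, add_mul, Finset.sum_sub_distrib,
          Finset.sum_add_distrib]
        push_cast
        ring_nf
      rw [norm_mul, hq, mul_pow, hw]
      refine mul_le_mul (norm_laguerreSeries_le h0 hF hx) ?_ (norm_nonneg _)
        (tsum_nonneg h0)
      rw [Real.norm_of_nonneg (by have := (expWeight_pos b x).le; positivity), mul_assoc]
      have := sq_le_sq.2 (hT.trans (le_abs_self _))
      have := (expWeight_pos b x).le
      gcongr
    · have hT : Filter.Tendsto (fun N => ∑ j ∈ Finset.range N,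
          (-∑ i, a i * x i) ^ j / j.factorial) Filter.atTop
          (nhds (Real.exp (-∑ i, a i * x i))) := by
        rw [Real.exp_eq_exp_ℝ]
        exact (NormedSpace.expSeries_div_hasSum_exp _).tendsto_sum_nat
      have hw : MvPolynomial.eval x p ^ 2 * expWeight (b + (a + a)) x
          = (MvPolynomial.eval x p * Real.exp (-∑ i, a i * x i)) ^ 2 * expWeight b x := by
        rw [expWeight_add, expWeight_add, expWeight, expWeight]
        ring
      simp only [hq, hw]
      exact ((((hT.const_mul _).pow 2).mul_const _).const_mul _)
  exact ge_of_tendsto' hlim fun N => h (q N)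

theorem NonnegOnSquares.add (h0 : ∀ k, 0 ≤ F k) (hF : Summable F)
    (h : NonnegOnSquares F fun _ => 1 / 2) {b : Fin M → ℝ} (hb : ∀ i, 0 ≤ b i) :
    NonnegOnSquares F ((fun _ => 1 / 2) + b) := by
  -- $K$ small steps, each adding $2a=b/K$ to the weight; $K>4\sum_i b_i$ ensures $a_i\le1/8$.
  obtain ⟨K, hK⟩ := exists_nat_gt (4 * ∑ i, b i)
  have hK0 : (0 : ℝ) < K :=
    (mul_nonneg zero_le_four (Finset.sum_nonneg fun i _ => hb i)).trans_lt hK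
  let a : Fin M → ℝ := fun i => b i / (2 * K)
  have ha : ∀ i, 0 ≤ a i := fun i => div_nonneg (hb i) (by positivity)
  have ha' : ∀ i, a i ≤ 1 / 8 := fun i => by
    have := Finset.single_le_sum (fun i _ => hb i) (Finset.mem_univ i)
    simp only [a]
    rw [div_le_iff₀ (by positivity)]
    linarith
  have main : ∀ N : ℕ, NonnegOnSquares F ((fun _ => 1 / 2) + (N : ℝ) • (a + a)) := by
    intro N
    induction N with
    | zero => simpa using h
    | succ N ih =>
      have := NonnegOnSquares.add_small h0 hF (fun i => ?_) ha ha' ih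
      · push_cast
        rwa [add_smul, one_smul, ← add_assoc]
      · have := ha i
        simp only [Pi.add_apply, Pi.smul_apply, smul_eq_mul]
        have : 0 ≤ (N : ℝ) * (a i + a i) := by positivity
        linarith
  convert main K using 2
  ext i
  simp only [a, Pi.smul_apply, Pi.add_apply, smul_eq_mul]
  field_simp
  ring

end Polynomials

/-! ### Peak functions and pointwise nonnegativity. -/

theorem mul_exp_one_sub_le_one (u : ℝ) : u * Real.exp (1 - u) ≤ 1 := by
  have h := Real.add_one_le_exp (u - 1)
  calc u * Real.exp (1 - u) ≤ Real.exp (u - 1) * Real.exp (1 - u) := by gcongr; linarith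
    _ = 1 := by rw [← Real.exp_add]; simp

/-- From $e^{u-1}\ge((1+u)/2)^2$ and $4u/(1+u)^2=1-(|u-1|/(1+u))^2$, where
$|u-1|/(1+u)\ge\varepsilon/(2+\varepsilon)$. -/
theorem mul_exp_one_sub_le {u ε : ℝ} (hu : 0 ≤ u) (hε : 0 < ε) (h : ε ≤ |u - 1|) :
    u * Real.exp (1 - u) ≤ 1 - (ε / (2 + ε)) ^ 2 := by
  have h1 : (1 + u) / 2 ≤ Real.exp ((u - 1) / 2) := by
    have := Real.add_one_le_exp ((u - 1) / 2)
    linarith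
  have h2 : ((1 + u) / 2) ^ 2 ≤ Real.exp (u - 1) := by
    have : Real.exp (u - 1) = Real.exp ((u - 1) / 2) ^ 2 := by
      rw [← Real.exp_nat_mul]; push_cast; ring_nf
    rw [this]
    gcongr
  have h3 : u * Real.exp (1 - u) ≤ u / ((1 + u) / 2) ^ 2 := by
    rw [show 1 - u = -(u - 1) by ring, Real.exp_neg, ← div_eq_mul_inv]
    gcongr
  have h4 : u / ((1 + u) / 2) ^ 2 = 1 - (|u - 1| / (1 + u)) ^ 2 := by
    rw [div_pow |u - 1|, sq_abs]
    field_simp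
    ring
  have h5 : ε / (2 + ε) ≤ |u - 1| / (1 + u) := by
    rw [div_le_div_iff₀ (by positivity) (by positivity)]
    rcases abs_cases (u - 1) with ⟨h6, _⟩ | ⟨h6, _⟩ <;> rw [h6] at h ⊢ <;> nlinarith
  rw [h4] at h3
  have : (ε / (2 + ε)) ^ 2 ≤ (|u - 1| / (1 + u)) ^ 2 := by gcongr
  linarith

/-- A function on the orthant with maximum `1`, attained only at `c`. -/
noncomputable def peak {M : ℕ} (c x : Fin M → ℝ) : ℝ :=
  ∏ i, (x i / c i * Real.exp (1 - x i / c i)) ^ 2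

section Peak

variable {M : ℕ} {c : Fin M → ℝ}

theorem continuous_peak (c : Fin M → ℝ) : Continuous (peak c) := by
  unfold peak; fun_prop

theorem peak_self (hc : ∀ i, 0 < c i) : peak c c = 1 :=
  Finset.prod_eq_one fun i _ => by simp [div_self (hc i).ne']

theorem peak_nonneg (c x : Fin M → ℝ) : 0 ≤ peak c x := Finset.prod_nonneg fun _ _ => sq_nonneg _

theorem peak_le_of_far (hc : ∀ i, 0 < c i) {x : Fin M → ℝ} (hx : ∀ i, 0 ≤ x i) {ε : ℝ}
    (hε : 0 < ε) {j : Fin M} (h : ε ≤ |x j / c j - 1|) :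
    peak c x ≤ 1 - (ε / (2 + ε)) ^ 2 := by
  have hg : ∀ i, 0 ≤ x i / c i * Real.exp (1 - x i / c i) := fun i =>
    mul_nonneg (div_nonneg (hx i) (hc i).le) (Real.exp_nonneg _)
  have hg1 : ∀ i, x i / c i * Real.exp (1 - x i / c i) ≤ 1 := fun i => mul_exp_one_sub_le_one _
  rw [peak, ← Finset.mul_prod_erase _ _ (Finset.mem_univ j)]
  calc _ ≤ (x j / c j * Real.exp (1 - x j / c j)) ^ 2 * 1 := by
        gcongr
        exact Finset.prod_le_one (fun _ _ => sq_nonneg _) fun i _ => pow_le_one₀ (hg i) (hg1 i)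
    _ ≤ x j / c j * Real.exp (1 - x j / c j) := by
        nlinarith [hg j, hg1 j]
    _ ≤ _ := mul_exp_one_sub_le (div_nonneg (hx j) (hc j).le) hε h

/-- The square in `peak` makes every power the square of a monomial times an exponential weight,
hence an admissible test function. -/
theorem peak_pow_mul_expWeight (t : ℕ) (x : Fin M → ℝ) :
    peak c x ^ t * expWeight (fun _ => 1 / 2) x =
      MvPolynomial.eval x
        (∏ i, (MvPolynomial.C (Real.exp 1 / c i) * MvPolynomial.X i) ^ t) ^ 2
      * expWeight ((fun _ => 1 / 2) + fun i => 2 * t / c i) x := by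
  rw [expWeight_add, mul_comm (expWeight (fun _ => 1 / 2) x), ← mul_assoc]
  congr 1
  rw [map_prod, expWeight_eq_prod, peak, ← Finset.prod_pow, ← Finset.prod_pow,
    ← Finset.prod_mul_distrib]
  refine Finset.prod_congr rfl fun i _ => ?_
  have e : Real.exp (-(2 * t / c i * x i)) = (Real.exp (-(x i / c i)) ^ t) ^ 2 := by
    rw [← pow_mul, ← Real.exp_nat_mul]
    push_cast
    ring_nf
  rw [e, sub_eq_add_neg, Real.exp_add]
  simp only [map_pow, map_mul, MvPolynomial.eval_C, MvPolynomial.eval_X]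
  rw [← pow_mul, ← pow_mul, ← pow_mul, mul_comm t 2, ← mul_pow]
  ring

variable {F : (Fin M → ℕ) → ℝ}

/-- If the series were negative at $c$, testing it against high powers of `peak c` would let the
negative part near $c$ outweigh everything away from $c$. -/
theorem NonnegOnSquares.nonneg_of_pos (h0 : ∀ k, 0 ≤ F k) (hF : Summable F)
    (h : NonnegOnSquares F fun _ => 1 / 2) (hc : ∀ i, 0 < c i) : 0 ≤ laguerreSeries F c := by
  by_contra! hneg
  set δ := -laguerreSeries F c / 2 with hδ
  have hδ0 : 0 < δ := by simp only [hδ]; linarith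
  set S := ∑' k, F k
  have hS : 0 ≤ S := tsum_nonneg h0
  have hcont : ContinuousWithinAt (laguerreSeries F) (Set.Ici 0) c :=
    continuousOn_laguerreSeries h0 hF c fun i => (hc i).le
  obtain ⟨ρ, hρ, hball⟩ := Metric.mem_nhdsWithin_iff.1
    (hcont.eventually_lt_const (show laguerreSeries F c < -δ by simp only [hδ]; linarith))
  have hcs : 0 ≤ ∑ i, c i := Finset.sum_nonneg fun i _ => (hc i).le
  -- Outside the ball some $|x_j-c_j|\ge\rho$, so $|x_j/c_j-1|\ge\rho/c_j\ge\varepsilon$; the $+1$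
  -- keeps the denominator positive when $M=0$.
  set ε := ρ / (∑ i, c i + 1) with hε
  have hε0 : 0 < ε := by positivity
  set η := 1 - (ε / (2 + ε)) ^ 2 with hη
  have hη0 : 0 ≤ η := by
    have h1 : ε / (2 + ε) ≤ 1 := (div_le_one (by positivity)).2 (by linarith)
    have : (ε / (2 + ε)) ^ 2 ≤ 1 := pow_le_one₀ (by positivity) h1
    linarith
  have hη1 : η < 1 := by
    have : 0 < (ε / (2 + ε)) ^ 2 := by positivity
    linarith
  have hfar : ∀ x, (∀ i, 0 ≤ x i) → x ∉ Metric.ball c ρ → peak c x ≤ η := by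
    intro x hx hxc
    rw [Metric.mem_ball, dist_pi_lt_iff hρ] at hxc
    push Not at hxc
    obtain ⟨j, hj⟩ := hxc
    refine peak_le_of_far hc hx hε0 (j := j) ?_
    have hcj : c j ≤ ∑ i, c i + 1 := by
      have := Finset.single_le_sum (fun i _ => (hc i).le) (Finset.mem_univ j)
      linarith
    rw [Real.dist_eq] at hj
    have hcj0 := hc j
    rw [div_sub_one hcj0.ne', abs_div, abs_of_pos hcj0]
    exact div_le_div₀ (abs_nonneg _) hj hcj0 hcj
  -- The peak is at most $\eta$ outside the ball and exceeds $\eta'>\eta$ on $V$; intersecting with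
  -- the open orthant makes $V$ an open set inside the support of the measure.
  set η' := (1 + η) / 2 with hη'
  set V : Set (Fin M → ℝ) := (Metric.ball c ρ ∩ {x | η' < peak c x}) ∩ {x | ∀ i, 0 < x i}
    with hV
  have hVo : IsOpen V := by
    refine (Metric.isOpen_ball.inter (isOpen_lt continuous_const (continuous_peak c))).inter ?_
    simp only [Set.ofPred_forall]
    exact isOpen_iInter_of_finite fun i => isOpen_lt continuous_const (continuous_apply i)
  have hcV : c ∈ V := ⟨⟨Metric.mem_ball_self hρ, by
    simp only [Set.mem_ofPred_eq, peak_self hc]; linarith⟩, hc⟩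
  set w : (Fin M → ℝ) → ℝ := expWeight fun _ => 1 / 2
  have hw0 : ∀ x, 0 < w x := expWeight_pos _
  have hw : Integrable w (orthantMeasure M) := by
    simpa only [monom, Pi.zero_apply, pow_zero, Finset.prod_const_one, one_mul] using
      integrable_monom_mul_expWeight (b := fun _ : Fin M => (1 / 2 : ℝ)) (fun _ => by norm_num) 0
  have hA : 0 < ∫ x, V.indicator w x ∂orthantMeasure M := by
    rw [integral_pos_iff_support_of_nonneg
      (fun x => Set.indicator_nonneg (fun x _ => (hw0 x).le) x)
      (hw.indicator hVo.measurableSet)]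
    have hs : Function.support (V.indicator w) = V := by
      rw [Set.support_indicator, Set.inter_eq_left]
      exact fun x _ => (hw0 x).ne'
    have hsub : V ∩ Set.Ici 0 = V := Set.inter_eq_left.2 fun x hx i => (hx.2 i).le
    rw [hs, orthantMeasure, Measure.restrict_apply hVo.measurableSet, hsub]
    exact hVo.measure_pos _ ⟨c, hcV⟩
  have key : ∀ t : ℕ, δ * η' ^ t * ∫ x, V.indicator w x ∂orthantMeasure M
      ≤ S * η ^ t * ∫ x, w x ∂orthantMeasure M := by
    intro t
    have h1 := NonnegOnSquares.add h0 hF h (b := fun i => 2 * t / c i)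
      (fun i => div_nonneg (by positivity) (hc i).le)
      (∏ i, (MvPolynomial.C (Real.exp 1 / c i) * MvPolynomial.X i) ^ t)
    simp only [← peak_pow_mul_expWeight] at h1
    have hi : Integrable (fun x => peak c x ^ t * w x) (orthantMeasure M) := by
      simp only [w, peak_pow_mul_expWeight]
      refine integrable_eval_sq_mul_expWeight (fun i => ?_) _
      have : 0 ≤ 2 * t / c i := div_nonneg (by positivity) (hc i).le
      simp only [Pi.add_apply]
      linarith
    have h2 : ∫ x, laguerreSeries F x * (peak c x ^ t * w x) ∂orthantMeasure M ≤
        ∫ x, (S * η ^ t * w x - δ * η' ^ t * V.indicator w x) ∂orthantMeasure M := by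
      refine integral_mono_ae (integrable_laguerreSeries_mul h0 hF hi)
        ((hw.const_mul _).sub ((hw.indicator hVo.measurableSet).const_mul _))
        ((ae_orthantMeasure_nonneg M).mono fun x hx => ?_)
      have hSx : 0 ≤ S * η ^ t * w x := by have := (hw0 x).le; positivity
      have hpw : 0 ≤ peak c x ^ t * w x := by
        have := (hw0 x).le; have := peak_nonneg c x; positivity
      dsimp only
      by_cases hxB : x ∈ Metric.ball c ρ
      · have hlt : laguerreSeries F x < -δ := hball ⟨hxB, hx⟩
        by_cases hxV : x ∈ V
        · rw [Set.indicator_of_mem hxV]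
          have : η' ^ t * w x ≤ peak c x ^ t * w x := by
            have h3 : η' ≤ peak c x := by simpa using hxV.1.2.out.le
            have := (hw0 x).le
            have : 0 ≤ η' := by positivity
            gcongr
          nlinarith
        · rw [Set.indicator_of_notMem hxV]
          nlinarith
      · rw [Set.indicator_of_notMem fun hxV => hxB hxV.1.1, mul_zero, sub_zero, mul_assoc]
        have h3 := hfar x hx hxB
        have h4 : peak c x ^ t * w x ≤ η ^ t * w x := by
          have := (hw0 x).le
          have := peak_nonneg c x
          gcongr
        exact mul_le_mul ((le_abs_self _).trans (norm_laguerreSeries_le h0 hF hx)) h4 hpw hS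
    rw [integral_sub (hw.const_mul _) ((hw.indicator hVo.measurableSet).const_mul _),
      integral_const_mul, integral_const_mul] at h2
    linarith
  have hη'0 : 0 < η' := by positivity
  -- Dividing `key` by $\eta'^t$ bounds a fixed positive number by a multiple of
  -- $(\eta/\eta')^t\to0$.
  have hlim : Filter.Tendsto (fun t : ℕ => S * (∫ x, w x ∂orthantMeasure M) * (η / η') ^ t)
      Filter.atTop (nhds (S * (∫ x, w x ∂orthantMeasure M) * 0)) :=
    (tendsto_pow_atTop_nhds_zero_of_lt_one (by positivity)
      ((div_lt_one hη'0).2 (by linarith))).const_mul _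
  have hle := ge_of_tendsto' hlim fun t => show
      δ * ∫ x, V.indicator w x ∂orthantMeasure M ≤ _ by
    rw [div_pow, ← mul_div_assoc, le_div_iff₀ (by positivity)]
    linarith [key t]
  have := mul_pos hδ0 hA
  linarith

/-- Boundary points are limits of interior ones, and the series is continuous on the closed orthant.
-/
theorem NonnegOnSquares.nonneg (h0 : ∀ k, 0 ≤ F k) (hF : Summable F)
    (h : NonnegOnSquares F fun _ => 1 / 2) {x : Fin M → ℝ} (hx : ∀ i, 0 ≤ x i) :
    0 ≤ laguerreSeries F x := by
  have hlim : Filter.Tendsto (fun s : ℝ => x + fun _ => s) (nhdsWithin 0 (Set.Ioi 0))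
      (nhdsWithin x (Set.Ici 0)) := by
    refine tendsto_nhdsWithin_iff.2 ⟨?_, ?_⟩
    · have : Continuous fun s : ℝ => x + fun _ => s := by fun_prop
      have h2 := this.tendsto 0
      have e : (x + fun _ => (0 : ℝ)) = x := by ext; simp
      rw [e] at h2
      exact h2.mono_left nhdsWithin_le_nhds
    · filter_upwards [self_mem_nhdsWithin] with s hs i
      exact add_nonneg (hx i) (le_of_lt hs)
  refine ge_of_tendsto ((continuousOn_laguerreSeries h0 hF x hx).tendsto.comp hlim) ?_
  filter_upwards [self_mem_nhdsWithin] with s hs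
  exact NonnegOnSquares.nonneg_of_pos h0 hF h fun i => add_pos_of_nonneg_of_pos (hx i) hs

end Peak

/-! ### Moment matrices and feasibility of the relaxations. -/

theorem sum_sum_ite_eq_mul_nonneg {ι κ : Type*} [Fintype ι] [Fintype κ] [DecidableEq κ]
    (π : ι → κ) (c : ι → ℝ) : 0 ≤ ∑ i, ∑ j, if π i = π j then c i * c j else 0 := by
  have e : ∑ i, ∑ j, (if π i = π j then c i * c j else 0)
      = ∑ e : κ, (∑ i, if π i = e then c i else 0) ^ 2 := by
    simp only [sq, Finset.sum_mul_sum]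
    rw [Finset.sum_comm]
    simp only [Finset.sum_comm (s := (Finset.univ : Finset κ))]
    rw [Finset.sum_comm]
    refine Finset.sum_congr rfl fun i _ => Finset.sum_congr rfl fun j _ => ?_
    by_cases h : π i = π j
    · simp [h]
    · simp [h, eq_comm]
  rw [e]
  exact Finset.sum_nonneg fun _ _ => sq_nonneg _

section

variable {M : ℕ} {I : Finset (Fin M → ℕ)}

/-- The extension by zero of a vector indexed by `I`. -/
noncomputable def extendZero {M : ℕ} {I : Finset (Fin M → ℕ)} (F : I → ℝ) (k : Fin M → ℕ) : ℝ :=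
  if h : k ∈ I then F ⟨k, h⟩ else 0

theorem extendZero_coe (F : I → ℝ) (k : I) : extendZero F k.1 = F k := by
  simp [extendZero]

theorem sum_filter_eq_laguerreMoment (hI : IsLowerSet (I : Set (Fin M → ℕ))) {G : I → ℝ}
    {F : (Fin M → ℕ) → ℝ} (hGF : ∀ k : I, G k = F k.1) (l : I) :
    ∑ k : I with ∀ a, k.1 a ≤ l.1 a, G k * (multiChoose l.1 k.1 : ℝ) * (multiFactorial l.1 : ℝ)
      = laguerreMoment F l.1 := by
  have hs : Finset.Iic l.1 = I.filter fun k => ∀ a, k a ≤ l.1 a := by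
    ext k
    simp only [Finset.mem_Iic, Finset.mem_filter, Pi.le_def]
    exact ⟨fun h => ⟨hI h l.2, h⟩, fun h => h.2⟩
  rw [laguerreMoment, hs, Finset.sum_filter, Finset.sum_filter, ← Finset.sum_coe_sort I]
  simp only [hGF]

theorem SDPFeasible.entry_eq_laguerreMoment {A : Matrix I I ℝ} {G : I → ℝ}
    (h : SDPFeasible I A G) (hI : IsLowerSet (I : Set (Fin M → ℕ))) {F : (Fin M → ℕ) → ℝ}
    (hGF : ∀ k : I, G k = F k.1) {l i j : I} (hl : i.1 + j.1 = 2 • l.1) :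
    A i j = laguerreMoment F l.1 :=
  (h.even_entry l i j hl).trans (sum_filter_eq_laguerreMoment hI hGF l)

/-- All constraints but the normalisation are homogeneous in $(A,F)$, so a common rescaling
suffices. -/
theorem exists_sdpFeasible_of_posSemidef (hI : IsLowerSet (I : Set (Fin M → ℕ)))
    {A : Matrix I I ℝ} {F : (Fin M → ℕ) → ℝ} (h0 : ∀ k, 0 ≤ F k) (hpos : 0 < ∑ k ∈ I, F k)
    (heven : ∀ l i j : I, i.1 + j.1 = 2 • l.1 → A i j = laguerreMoment F l.1)
    (hodd : ∀ i j : I, (∀ l : I, i.1 + j.1 ≠ 2 • l.1) → A i j = 0) (hA : A.PosSemidef) :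
    ∃ B : Matrix I I ℝ, SDPFeasible I B fun k => F k.1 / ∑ k ∈ I, F k := by
  refine ⟨(∑ k ∈ I, F k)⁻¹ • A, ?_, fun k => div_nonneg (h0 _) hpos.le, fun l i j hl => ?_,
    fun i j hl => ?_, hA.smul (by positivity)⟩
  · rw [← Finset.sum_div, Finset.sum_coe_sort I F, div_self hpos.ne']
  · rw [sum_filter_eq_laguerreMoment hI (F := fun k => F k / ∑ k ∈ I, F k) (fun _ => rfl),
      Matrix.smul_apply, heven l i j hl, laguerreMoment, laguerreMoment, smul_eq_mul,
      Finset.mul_sum]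
    exact Finset.sum_congr rfl fun k _ => by ring
  · rw [Matrix.smul_apply, hodd i j hl, smul_zero]

/-- The moment matrix of a Laguerre series, with zero entries at the pairs of unequal parity. -/
noncomputable def parityMomentMatrix {M : ℕ} (I : Finset (Fin M → ℕ)) (F : (Fin M → ℕ) → ℝ) :
    Matrix I I ℝ := fun i j =>
  if (fun a => (i.1 a : ZMod 2)) = fun a => (j.1 a : ZMod 2) then
    laguerreMoment F fun a => (i.1 a + j.1 a) / 2 else 0

theorem two_smul_half_add {i j : Fin M → ℕ}
    (h : (fun a => (i a : ZMod 2)) = fun a => (j a : ZMod 2)) :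
    i + j = 2 • fun a => (i a + j a) / 2 := by
  ext a
  have h1 := (ZMod.natCast_eq_natCast_iff' _ _ _).1 (congrFun h a)
  simp only [Pi.add_apply, Pi.smul_apply, smul_eq_mul]
  omega

theorem eq_half_add {i j l : Fin M → ℕ} (h : i + j = 2 • l) :
    (fun a => (i a : ZMod 2)) = (fun a => (j a : ZMod 2)) ∧ l = fun a => (i a + j a) / 2 := by
  have h1 : ∀ a, i a + j a = 2 * l a := fun a => by simpa using congrFun h a
  refine ⟨funext fun a => (ZMod.natCast_eq_natCast_iff' _ _ _).2 ?_, funext fun a => ?_⟩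
  · have := h1 a
    omega
  · rw [h1 a]
    omega

theorem monom_sqrt_mul_monom_sqrt {i j l : Fin M → ℕ} (h : i + j = 2 • l) {x : Fin M → ℝ}
    (hx : ∀ a, 0 ≤ x a) :
    monom i (fun a => √(x a)) * monom j (fun a => √(x a)) = monom l x := by
  rw [← monom_add, h]
  refine Finset.prod_congr rfl fun a _ => ?_
  simp only [Pi.smul_apply, smul_eq_mul]
  rw [pow_mul, Real.sq_sqrt (hx a)]

/-- For $i+j=2l$, $x^l=\sqrt x^{\,i}\sqrt x^{\,j}$. The quadratic form is thus the integral of the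
nonnegative weighted series times a sum of squares, one per parity class of indices. -/
theorem posSemidef_parityMomentMatrix {F : (Fin M → ℕ) → ℝ} (h0 : ∀ k, 0 ≤ F k)
    (hF : Summable F) (h : ∀ x : Fin M → ℝ, (∀ i, 0 ≤ x i) → 0 ≤ laguerreSeries F x) :
    (parityMomentMatrix I F).PosSemidef := by
  refine Matrix.PosSemidef.of_dotProduct_mulVec_nonneg ?_ fun v => ?_
  · ext i j
    simp only [Matrix.conjTranspose_apply, parityMomentMatrix, star_trivial]
    simp only [add_comm, eq_comm]
  · let π : I → Fin M → ZMod 2 := fun i a => (i.1 a : ZMod 2)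
    let g : I → I → (Fin M → ℝ) → ℝ := fun i j x => if π i = π j then v i * v j *
      (laguerreSeries F x * (monom (fun a => (i.1 a + j.1 a) / 2) x
        * expWeight (fun _ => 1 / 2) x)) else 0
    have hg : ∀ i j, Integrable (g i j) (orthantMeasure M) := by
      intro i j
      by_cases hij : π i = π j
      · simp only [g, if_pos hij]
        exact (integrable_laguerreSeries_mul h0 hF
          (integrable_monom_mul_expWeight (fun _ => by norm_num) _)).const_mul _
      · simp only [g, if_neg hij]
        exact integrable_zero _ _ _
    have e : star v ⬝ᵥ (parityMomentMatrix I F).mulVec v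
        = ∫ x, ∑ i, ∑ j, g i j x ∂orthantMeasure M := by
      rw [integral_finsetSum _ fun i _ => integrable_finsetSum _ fun j _ => hg i j]
      simp only [dotProduct, Matrix.mulVec, Finset.mul_sum]
      refine Finset.sum_congr rfl fun i _ => ?_
      rw [integral_finsetSum _ fun j _ => hg i j]
      refine Finset.sum_congr rfl fun j _ => ?_
      by_cases hij : π i = π j
      · simp only [g, if_pos hij]
        rw [integral_const_mul, integral_laguerreSeries_mul_monom h0 hF, parityMomentMatrix,
          if_pos hij, Pi.star_apply, star_trivial]
        ring
      · simp only [g, if_neg hij]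
        rw [parityMomentMatrix, if_neg hij]
        simp
    rw [e]
    refine integral_nonneg_of_ae ((ae_orthantMeasure_nonneg M).mono fun x hx => ?_)
    have e2 : ∑ i, ∑ j, g i j x = laguerreSeries F x * expWeight (fun _ => 1 / 2) x *
        ∑ i, ∑ j, if π i = π j then (v i * monom i.1 fun a => √(x a)) *
          (v j * monom j.1 fun a => √(x a)) else 0 := by
      rw [Finset.mul_sum]
      refine Finset.sum_congr rfl fun i _ => ?_
      rw [Finset.mul_sum]
      refine Finset.sum_congr rfl fun j _ => ?_
      by_cases hij : π i = π j
      · simp only [g, if_pos hij]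
        rw [← monom_sqrt_mul_monom_sqrt (two_smul_half_add hij) hx]
        ring
      · simp only [g, if_neg hij, mul_zero]
    simp only [Pi.zero_apply, e2]
    exact mul_nonneg (mul_nonneg (h x hx) (expWeight_pos _ _).le)
      (sum_sum_ite_eq_mul_nonneg _ _)

theorem exists_sdpFeasible_of_laguerreSeries_nonneg (hI : IsLowerSet (I : Set (Fin M → ℕ)))
    (hmid : ∀ l i j : Fin M → ℕ, i ∈ I → j ∈ I → i + j = 2 • l → l ∈ I)
    {F : (Fin M → ℕ) → ℝ} (h0 : ∀ k, 0 ≤ F k) (hF : Summable F)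
    (h : ∀ x : Fin M → ℝ, (∀ i, 0 ≤ x i) → 0 ≤ laguerreSeries F x) (hpos : 0 < ∑ k ∈ I, F k) :
    ∃ B : Matrix I I ℝ, SDPFeasible I B fun k => F k.1 / ∑ k ∈ I, F k := by
  refine exists_sdpFeasible_of_posSemidef hI h0 hpos (fun l i j hl => ?_) (fun i j hl => ?_)
    (posSemidef_parityMomentMatrix h0 hF h)
  · obtain ⟨h1, h2⟩ := eq_half_add hl
    rw [parityMomentMatrix, if_pos h1, ← h2]
  · rw [parityMomentMatrix, if_neg]
    intro h1
    have h2 := two_smul_half_add h1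
    exact hl ⟨_, hmid _ _ _ i.2 j.2 h2⟩ h2

theorem extendZero_nonneg {A : Matrix I I ℝ} {G : I → ℝ} (h : SDPFeasible I A G)
    (k : Fin M → ℕ) : 0 ≤ extendZero G k := by
  unfold extendZero; split_ifs <;> simp [h.nonneg]

/-- A principal submatrix stays positive semidefinite, and entries for $l\in I$ involve only $k\le
l$, which lie in the lower set $I$. -/
theorem SDPFeasible.exists_restrict {J : Finset (Fin M → ℕ)} {A : Matrix J J ℝ} {G : J → ℝ}
    (h : SDPFeasible J A G) (hI : IsLowerSet (I : Set (Fin M → ℕ)))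
    (hJ : IsLowerSet (J : Set (Fin M → ℕ)))
    (hmid : ∀ l i j : Fin M → ℕ, i ∈ I → j ∈ I → i + j = 2 • l → l ∈ I) (hIJ : I ⊆ J)
    (hpos : 0 < ∑ k ∈ I, extendZero G k) :
    ∃ B : Matrix I I ℝ, SDPFeasible I B fun k => extendZero G k.1 / ∑ k ∈ I, extendZero G k := by
  refine exists_sdpFeasible_of_posSemidef hI (extendZero_nonneg h) hpos
    (A := A.submatrix (fun k : I => ⟨k.1, hIJ k.2⟩) fun k : I => ⟨k.1, hIJ k.2⟩)
    (fun l i j hl => ?_) (fun i j hl => ?_) (h.posSemidef.submatrix _)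
  · exact h.entry_eq_laguerreMoment hJ (fun k => (extendZero_coe G k).symm)
      (l := ⟨l.1, hIJ l.2⟩) hl
  · exact h.odd_entry _ _ fun l hl' => hl ⟨l.1, hmid _ _ _ i.2 j.2 hl'⟩ hl'

theorem sum_extendZero_le_one {A : Matrix I I ℝ} {G : I → ℝ} (h : SDPFeasible I A G)
    (s : Finset (Fin M → ℕ)) : ∑ k ∈ s, extendZero G k ≤ 1 := by
  rw [← h.sum_eq_one]
  simp only [← extendZero_coe G]
  rw [Finset.sum_coe_sort I (extendZero G)]
  calc _ = ∑ k ∈ s with k ∈ I, extendZero G k := by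
        rw [Finset.sum_filter]
        refine Finset.sum_congr rfl fun k _ => ?_
        split_ifs with hk
        · rfl
        · simp [extendZero, hk]
    _ ≤ _ := Finset.sum_le_sum_of_subset_of_nonneg
        (fun k hk => (Finset.mem_filter.1 hk).2) fun k _ _ => extendZero_nonneg h k

theorem extendZero_le_one {A : Matrix I I ℝ} {G : I → ℝ} (h : SDPFeasible I A G)
    (k : Fin M → ℕ) : extendZero G k ≤ 1 := by
  simpa using sum_extendZero_le_one h {k}

theorem SDPFeasible.laguerreMoment_form_nonneg {A : Matrix I I ℝ} {G : I → ℝ}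
    (h : SDPFeasible I A G) (hI : IsLowerSet (I : Set (Fin M → ℕ)))
    (hmid : ∀ l i j : Fin M → ℕ, i ∈ I → j ∈ I → i + j = 2 • l → l ∈ I)
    (s : Finset (Fin M →₀ ℕ)) (hs : ∀ i ∈ s, 2 • (i : Fin M → ℕ) ∈ I) (c : (Fin M →₀ ℕ) → ℝ) :
    0 ≤ ∑ i ∈ s, ∑ j ∈ s, c i * laguerreMoment (extendZero G) (i + j) * c j := by
  -- Only the rows $2i$ are needed: the entry at $(2i,2j)$ is the moment of order $i+j$.
  have h1 := (h.posSemidef.submatrix fun i : s =>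
    ⟨2 • (i.1 : Fin M → ℕ), hs i.1 i.2⟩).dotProduct_mulVec_nonneg fun i : s => c i.1
  refine h1.trans_eq ?_
  rw [← Finset.sum_coe_sort s]
  refine Finset.sum_congr rfl fun i _ => ?_
  rw [← Finset.sum_coe_sort s]
  simp only [Matrix.mulVec, dotProduct, Finset.mul_sum]
  refine Finset.sum_congr rfl fun j _ => ?_
  have e : 2 • (i.1 : Fin M → ℕ) + 2 • (j.1 : Fin M → ℕ)
      = 2 • ((i.1 : Fin M → ℕ) + (j.1 : Fin M → ℕ)) := (smul_add _ _ _).symm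
  rw [Matrix.submatrix_apply, h.entry_eq_laguerreMoment hI
    (fun k => (extendZero_coe G k).symm)
    (l := ⟨_, hmid _ _ _ (hs i.1 i.2) (hs j.1 j.2) e⟩) e]
  simp only [Pi.star_apply, star_trivial]
  ring

end

/-! ### Optimal values: comparison, monotonicity and convergence. -/

section Values

variable {M : ℕ} {n : Fin M → ℕ}

theorem lpFeasible_div_tsum {F : (Fin M → ℕ) → ℝ} (h0 : ∀ k, 0 ≤ F k) (hF : Summable F)
    (h : ∀ x : Fin M → ℝ, (∀ i, 0 ≤ x i) → 0 ≤ laguerreSeries F x) (hpos : 0 < ∑' k, F k) :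
    LPFeasible fun k => F k / ∑' k, F k := by
  have h0' : ∀ k, 0 ≤ F k / ∑' k, F k := fun k => div_nonneg (h0 k) hpos.le
  have hs : Summable fun k => F k / ∑' k, F k := hF.div_const _
  refine ⟨?_, ?_, h0', fun x hx => summable_mul_multiLaguerreFun h0' hs hx, fun x hx => ?_⟩
  · refine memℓp_gen ?_
    simp only [ENNReal.toReal_ofNat, Real.rpow_ofNat, Real.norm_eq_abs, sq_abs]
    refine hs.of_nonneg_of_le (fun k => sq_nonneg _) fun k => ?_
    rw [sq]
    exact mul_le_of_le_one_left (h0' k)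
      ((div_le_one hpos).2 (hF.le_tsum k fun j _ => h0 j))
  · have := hF.hasSum.div_const (∑' k, F k)
    rwa [div_self hpos.ne'] at this
  · simp only [div_mul_eq_mul_div, tsum_div_const]
    exact div_nonneg (h x hx) hpos.le

theorem lpFeasible_single_zero : LPFeasible (Pi.single (0 : Fin M → ℕ) (1 : ℝ)) := by
  have h0 : ∀ k, 0 ≤ (Pi.single (0 : Fin M → ℕ) (1 : ℝ) : (Fin M → ℕ) → ℝ) k := fun k => by
    rw [Pi.single_apply]; split_ifs <;> norm_num
  have hs : HasSum (Pi.single (0 : Fin M → ℕ) (1 : ℝ)) 1 := hasSum_pi_single _ _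
  have h := lpFeasible_div_tsum h0 hs.summable (fun x hx => ?_) (by rw [hs.tsum_eq]; norm_num)
  · simpa only [hs.tsum_eq, div_one] using h
  · rw [laguerreSeries, tsum_eq_single 0 fun k hk => by rw [Pi.single_eq_of_ne hk, zero_mul]]
    rw [Pi.single_eq_same, one_mul]
    exact Finset.prod_nonneg fun i _ => by
      simp only [laguerreFun, laguerrePoly, Pi.zero_apply]
      simp [Real.exp_nonneg]

theorem isLUB_lpValues (n : Fin M → ℕ) : IsLUB (lpValues n) (lpOptimum n) := by
  refine isLUB_csSup ⟨_, _, lpFeasible_single_zero, rfl⟩ ⟨1, ?_⟩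
  rintro v ⟨F, hF, rfl⟩
  exact le_hasSum hF.hasSum n fun j _ => hF.nonneg j

theorem lpOptimum_nonneg (n : Fin M → ℕ) : 0 ≤ lpOptimum n :=
  (lpFeasible_single_zero.nonneg n).trans
    ((isLUB_lpValues n).1 ⟨_, lpFeasible_single_zero, rfl⟩)

variable {I J : Finset (Fin M → ℕ)}

theorem bddAbove_sdpValues (I : Finset (Fin M → ℕ)) (n : Fin M → ℕ) :
    BddAbove (sdpValues I n) := by
  refine ⟨1, ?_⟩
  rintro v ⟨hn, A, G, hG, rfl⟩
  rw [← extendZero_coe G]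
  exact extendZero_le_one hG n

theorem le_sdpOptimum {A : Matrix I I ℝ} {G : I → ℝ} (hG : SDPFeasible I A G) (hn : n ∈ I) :
    G ⟨n, hn⟩ ≤ sdpOptimum I n :=
  le_csSup (bddAbove_sdpValues I n) ⟨hn, A, G, hG, rfl⟩

theorem sdpValues_nonempty (hI : IsLowerSet (I : Set (Fin M → ℕ)))
    (hmid : ∀ l i j : Fin M → ℕ, i ∈ I → j ∈ I → i + j = 2 • l → l ∈ I) (hn : n ∈ I) :
    (sdpValues I n).Nonempty := by
  have hz : (0 : Fin M → ℕ) ∈ I := hI (fun _ => Nat.zero_le _) hn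
  have h := lpFeasible_single_zero (M := M)
  obtain ⟨B, hB⟩ := exists_sdpFeasible_of_laguerreSeries_nonneg hI hmid h.nonneg
    h.hasSum.summable h.laguerre_nonneg <|
    Finset.sum_pos' (fun k _ => h.nonneg k) ⟨0, hz, by simp⟩
  exact ⟨_, hn, B, _, hB, rfl⟩

theorem isLUB_sdpValues (hI : IsLowerSet (I : Set (Fin M → ℕ)))
    (hmid : ∀ l i j : Fin M → ℕ, i ∈ I → j ∈ I → i + j = 2 • l → l ∈ I) (hn : n ∈ I) :
    IsLUB (sdpValues I n) (sdpOptimum I n) :=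
  isLUB_csSup (sdpValues_nonempty hI hmid hn) (bddAbove_sdpValues I n)

theorem sdpOptimum_nonneg (I : Finset (Fin M → ℕ)) (n : Fin M → ℕ) : 0 ≤ sdpOptimum I n := by
  refine Real.sSup_nonneg ?_
  rintro v ⟨hn, A, G, hG, rfl⟩
  exact hG.nonneg _

theorem sdpOptimum_anti (hI : IsLowerSet (I : Set (Fin M → ℕ)))
    (hJ : IsLowerSet (J : Set (Fin M → ℕ)))
    (hmid : ∀ l i j : Fin M → ℕ, i ∈ I → j ∈ I → i + j = 2 • l → l ∈ I) (hIJ : I ⊆ J)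
    (hn : n ∈ I) : sdpOptimum J n ≤ sdpOptimum I n := by
  refine Real.sSup_le ?_ (sdpOptimum_nonneg I n)
  rintro v ⟨hnJ, A, G, hG, rfl⟩
  rw [← extendZero_coe G]
  -- A positive entry at $n$ guarantees positive mass on $I$, needed to renormalise; a zero entry is
  -- bounded trivially.
  rcases (extendZero_nonneg hG n).eq_or_lt with h | h
  · rw [← h]
    exact sdpOptimum_nonneg I n
  · have hpos : 0 < ∑ k ∈ I, extendZero G k :=
      Finset.sum_pos' (fun k _ => extendZero_nonneg hG k) ⟨n, hn, h⟩
    obtain ⟨B, hB⟩ := hG.exists_restrict hI hJ hmid hIJ hpos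
    exact (le_div_self h.le hpos (sum_extendZero_le_one hG I)).trans (le_sdpOptimum hB hn)

theorem lpOptimum_le_sdpOptimum (hI : IsLowerSet (I : Set (Fin M → ℕ)))
    (hmid : ∀ l i j : Fin M → ℕ, i ∈ I → j ∈ I → i + j = 2 • l → l ∈ I) (hn : n ∈ I) :
    lpOptimum n ≤ sdpOptimum I n := by
  refine Real.sSup_le ?_ (sdpOptimum_nonneg I n)
  rintro v ⟨F, hF, rfl⟩
  rcases (hF.nonneg n).eq_or_lt with h | h
  · rw [← h]
    exact sdpOptimum_nonneg I n
  · have hpos : 0 < ∑ k ∈ I, F k := Finset.sum_pos' (fun k _ => hF.nonneg k) ⟨n, hn, h⟩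
    obtain ⟨B, hB⟩ := exists_sdpFeasible_of_laguerreSeries_nonneg hI hmid hF.nonneg
      hF.hasSum.summable hF.laguerre_nonneg hpos
    exact (le_div_self h.le hpos (sum_le_hasSum I (fun k _ => hF.nonneg k) hF.hasSum)).trans
      (le_sdpOptimum hB hn)

theorem tendsto_laguerreMoment {G : ℕ → (Fin M → ℕ) → ℝ} {F : (Fin M → ℕ) → ℝ}
    (h : Filter.Tendsto G Filter.atTop (nhds F)) (l : Fin M → ℕ) :
    Filter.Tendsto (fun m => laguerreMoment (G m) l) Filter.atTop (nhds (laguerreMoment F l)) :=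
  tendsto_finsetSum _ fun k _ => (((tendsto_pi_nhds.1 h k).mul_const _).mul_const _)

/-- A limit of feasible points of relaxations exhausting all multi-indices yields a lower bound
on the optimum of the linear program. -/
theorem le_lpOptimum_of_tendsto {I : ℕ → Finset (Fin M → ℕ)}
    (hI : ∀ m, IsLowerSet (I m : Set (Fin M → ℕ)))
    (hmid : ∀ m, ∀ l i j : Fin M → ℕ, i ∈ I m → j ∈ I m → i + j = 2 • l → l ∈ I m)
    (hex : ∀ k, ∀ᶠ m in Filter.atTop, k ∈ I m) {A : ∀ m, Matrix (I m) (I m) ℝ}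
    {G : ∀ m, I m → ℝ} (hG : ∀ m, SDPFeasible (I m) (A m) (G m)) {F : (Fin M → ℕ) → ℝ}
    (hlim : Filter.Tendsto (fun m => extendZero (G m)) Filter.atTop (nhds F)) :
    F n ≤ lpOptimum n := by
  have hlim' := tendsto_pi_nhds.1 hlim
  have h0 : ∀ k, 0 ≤ F k := fun k =>
    ge_of_tendsto' (hlim' k) fun m => extendZero_nonneg (hG m) k
  have hle : ∀ s : Finset (Fin M → ℕ), ∑ k ∈ s, F k ≤ 1 := fun s =>
    le_of_tendsto' (tendsto_finsetSum s fun k _ => hlim' k) fun m =>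
      sum_extendZero_le_one (hG m) s
  have hF : Summable F := summable_of_sum_le h0 hle
  have hnn : NonnegOnSquares F fun _ => 1 / 2 := by
    refine nonnegOnSquares_of_moments h0 hF fun s c => ?_
    refine ge_of_tendsto (tendsto_finsetSum s fun i _ => tendsto_finsetSum s fun j _ =>
      ((tendsto_laguerreMoment hlim (i + j)).const_mul (c i)).mul_const (c j)) ?_
    have hs : ∀ᶠ m in Filter.atTop, ∀ i ∈ s, 2 • (i : Fin M → ℕ) ∈ I m :=
      (Filter.eventually_all_finset s).2 fun i _ => hex _
    exact hs.mono fun m hm => (hG m).laguerreMoment_form_nonneg (hI m) (hmid m) s hm c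
  -- Mass may escape to infinity, so the limit sums only to at most $1$; renormalising can only
  -- increase the entry at $n$.
  rcases (h0 n).eq_or_lt with h | h
  · rw [← h]
    exact lpOptimum_nonneg n
  · have hpos : 0 < ∑' k, F k := hF.tsum_pos h0 n h
    exact (le_div_self h.le hpos (Real.tsum_le_of_sum_le h0 hle)).trans
      ((isLUB_lpValues n).1 ⟨_, lpFeasible_div_tsum h0 hF (fun x hx => hnn.nonneg h0 hF hx) hpos,
        rfl⟩)

/-- Were the values frequently at least $a>\omega_n^{L^2}$, feasible points with $n$-entry above
some $b\in(\omega_n^{L^2},a)$ would accumulate, by compactness of the cube, at a limit with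
$n$-entry at least $b$. -/
theorem tendsto_sdpOptimum {I : ℕ → Finset (Fin M → ℕ)}
    (hI : ∀ m, IsLowerSet (I m : Set (Fin M → ℕ)))
    (hmid : ∀ m, ∀ l i j : Fin M → ℕ, i ∈ I m → j ∈ I m → i + j = 2 • l → l ∈ I m)
    (hex : ∀ k, ∀ᶠ m in Filter.atTop, k ∈ I m) :
    Filter.Tendsto (fun m => sdpOptimum (I m) n) Filter.atTop (nhds (lpOptimum n)) := by
  refine tendsto_order.2 ⟨fun a ha => (hex n).mono fun m hm =>
    ha.trans_le (lpOptimum_le_sdpOptimum (hI m) (hmid m) hm), fun a ha => ?_⟩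
  by_contra hcon
  obtain ⟨b, hb, hba⟩ := exists_between ha
  obtain ⟨φ, hφ, hφ'⟩ := Filter.extraction_of_frequently_atTop
    ((Filter.not_eventually.1 hcon).and_eventually (hex n))
  have hch : ∀ m, ∃ (A : Matrix (I (φ m)) (I (φ m)) ℝ) (G : I (φ m) → ℝ),
      SDPFeasible (I (φ m)) A G ∧ b < extendZero G n := by
    intro m
    obtain ⟨h1, h2⟩ := hφ' m
    obtain ⟨v, ⟨hn, A, G, hG, rfl⟩, hv⟩ := exists_lt_of_lt_csSup
      (sdpValues_nonempty (hI _) (hmid _) h2) (hba.trans_le (not_lt.1 h1))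
    exact ⟨A, G, hG, by rwa [← extendZero_coe G] at hv⟩
  choose A G hG hb' using hch
  obtain ⟨F, -, ψ, hψ, hlim⟩ := (isCompact_univ_pi fun _ : Fin M → ℕ =>
    isCompact_Icc (a := (0 : ℝ)) (b := 1)).tendsto_subseq
    (x := fun m => extendZero (G m))
    fun m k _ => ⟨extendZero_nonneg (hG m) k, extendZero_le_one (hG m) k⟩
  have h1 : F n ≤ lpOptimum n := le_lpOptimum_of_tendsto (I := fun m => I (φ (ψ m)))
    (fun m => hI _) (fun m => hmid _)
    (fun k => (hφ.comp hψ).tendsto_atTop.eventually (hex k)) (fun m => hG (ψ m)) hlim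
  have h2 : b ≤ F n := ge_of_tendsto' (tendsto_pi_nhds.1 hlim n) fun m => (hb' (ψ m)).le
  linarith

end Values

/-! ### Box and total-degree index sets: lower, midpoint-closed and exhausting. -/

section Indices

variable {M : ℕ}

theorem isLowerSet_boxIndices (m : ℕ) : IsLowerSet (boxIndices M m : Set (Fin M → ℕ)) := by
  intro k l hlk hk
  rw [Finset.mem_coe, mem_boxIndices] at hk ⊢
  exact fun i => (hlk i).trans (hk i)

theorem isLowerSet_degreeIndices (m : ℕ) : IsLowerSet (degreeIndices M m : Set (Fin M → ℕ)) := by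
  intro k l hlk hk
  rw [Finset.mem_coe, mem_degreeIndices] at hk ⊢
  exact (Finset.sum_le_sum fun i _ => hlk i).trans hk

theorem mem_boxIndices_of_add_eq (m : ℕ) (l i j : Fin M → ℕ) (hi : i ∈ boxIndices M m)
    (hj : j ∈ boxIndices M m) (h : i + j = 2 • l) : l ∈ boxIndices M m := by
  rw [mem_boxIndices] at hi hj ⊢
  intro a
  have h1 : i a + j a = 2 * l a := by simpa using congrFun h a
  have := hi a
  have := hj a
  omega

theorem mem_degreeIndices_of_add_eq (m : ℕ) (l i j : Fin M → ℕ) (hi : i ∈ degreeIndices M m)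
    (hj : j ∈ degreeIndices M m) (h : i + j = 2 • l) : l ∈ degreeIndices M m := by
  rw [mem_degreeIndices] at hi hj ⊢
  have h1 : ∑ a, i a + ∑ a, j a = 2 * ∑ a, l a := by
    rw [← Finset.sum_add_distrib, Finset.mul_sum]
    exact Finset.sum_congr rfl fun a _ => by simpa using congrFun h a
  omega

theorem boxIndices_mono {m m' : ℕ} (h : m ≤ m') : boxIndices M m ⊆ boxIndices M m' := by
  intro k hk
  rw [mem_boxIndices] at hk ⊢
  exact fun i => (hk i).trans h

theorem degreeIndices_mono {m m' : ℕ} (h : m ≤ m') : degreeIndices M m ⊆ degreeIndices M m' := by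
  intro k hk
  rw [mem_degreeIndices] at hk ⊢
  exact hk.trans h

theorem eventually_mem_degreeIndices (k : Fin M → ℕ) :
    ∀ᶠ m in Filter.atTop, k ∈ degreeIndices M m :=
  (Filter.eventually_ge_atTop (∑ i, k i)).mono fun _ hm => mem_degreeIndices.2 hm

theorem eventually_mem_boxIndices (k : Fin M → ℕ) :
    ∀ᶠ m in Filter.atTop, k ∈ boxIndices M m :=
  (eventually_mem_degreeIndices k).mono fun _ hm => (Finset.mem_filter.1 hm).1

end Indices
end WignerSDP

theorem mainTheorem11 (M : ℕ) (n : Fin M → ℕ) :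
    IsLUB (WignerSDP.lpValues n) (WignerSDP.lpOptimum n) ∧
    ((∀ m : ℕ, (∀ i, n i ≤ m) →
        IsLUB (WignerSDP.sdpValues (WignerSDP.boxIndices M m) n)
          (WignerSDP.sdpOptimum (WignerSDP.boxIndices M m) n)) ∧
      AntitoneOn (fun m : ℕ => WignerSDP.sdpOptimum (WignerSDP.boxIndices M m) n)
        {m : ℕ | ∀ i, n i ≤ m} ∧
      Filter.Tendsto (fun m : ℕ => WignerSDP.sdpOptimum (WignerSDP.boxIndices M m) n)
        Filter.atTop (nhds (WignerSDP.lpOptimum n))) ∧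
    ((∀ m : ℕ, ∑ i, n i ≤ m →
        IsLUB (WignerSDP.sdpValues (WignerSDP.degreeIndices M m) n)
          (WignerSDP.sdpOptimum (WignerSDP.degreeIndices M m) n)) ∧
      AntitoneOn (fun m : ℕ => WignerSDP.sdpOptimum (WignerSDP.degreeIndices M m) n)
        {m : ℕ | ∑ i, n i ≤ m} ∧
      Filter.Tendsto (fun m : ℕ => WignerSDP.sdpOptimum (WignerSDP.degreeIndices M m) n)
        Filter.atTop (nhds (WignerSDP.lpOptimum n))) := by
  have hbox : ∀ m, (∀ i, n i ≤ m) → n ∈ WignerSDP.boxIndices M m :=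
    fun m hm => WignerSDP.mem_boxIndices.2 hm
  have hdeg : ∀ m, ∑ i, n i ≤ m → n ∈ WignerSDP.degreeIndices M m :=
    fun m hm => WignerSDP.mem_degreeIndices.2 hm
  refine ⟨WignerSDP.isLUB_lpValues n, ⟨fun m hm => ?_, fun m hm m' _ hmm' => ?_, ?_⟩,
    fun m hm => ?_, fun m hm m' _ hmm' => ?_, ?_⟩
  · exact WignerSDP.isLUB_sdpValues (WignerSDP.isLowerSet_boxIndices m)
      (WignerSDP.mem_boxIndices_of_add_eq m) (hbox m hm)
  · exact WignerSDP.sdpOptimum_anti (WignerSDP.isLowerSet_boxIndices m)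
      (WignerSDP.isLowerSet_boxIndices m') (WignerSDP.mem_boxIndices_of_add_eq m)
      (WignerSDP.boxIndices_mono hmm') (hbox m hm)
  · exact WignerSDP.tendsto_sdpOptimum WignerSDP.isLowerSet_boxIndices
      WignerSDP.mem_boxIndices_of_add_eq WignerSDP.eventually_mem_boxIndices
  · exact WignerSDP.isLUB_sdpValues (WignerSDP.isLowerSet_degreeIndices m)
      (WignerSDP.mem_degreeIndices_of_add_eq m) (hdeg m hm)
  · exact WignerSDP.sdpOptimum_anti (WignerSDP.isLowerSet_degreeIndices m)
      (WignerSDP.isLowerSet_degreeIndices m') (WignerSDP.mem_degreeIndices_of_add_eq m)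
      (WignerSDP.degreeIndices_mono hmm') (hdeg m hm)
  · exact WignerSDP.tendsto_sdpOptimum WignerSDP.isLowerSet_degreeIndices
      WignerSDP.mem_degreeIndices_of_add_eq WignerSDP.eventually_mem_degreeIndices
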